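/- For a measurable function $K:\mathbb{R}\to\mathbb{C}$ with $K(u)|u|^{-1/2}\in L^1(\mathbb{R})$ let $\mathcal{H}_K$ be the Hausdorff operator, bounded on $L^2(\mathbb{R})$ and given by $(\mathcal{H}_Kf)(x)=\int_{\mathbb{R}}K(u)f(ux)\,du$, and let $\mathcal{C}=\mathcal{H}_{\chi_{(0,1)}}$, $(\mathcal{C}f)(x)=\int_0^1f(ux)\,du=\frac1x\int_0^xf(t)\,dt$, be the Cesàro operator on $L^2(\mathbb{R})$. Regard $L^2[0,1]$ as the subspace of $L^2(\mathbb{R})$ of functions vanishing a.e. outside $[0,1]$. For a bounded operator $A$ on $L^2(\mathbb{R})$ let $A_1$ be its bi-restriction to $L^2[0,1]$, i.e. the operator on $L^2[0,1]$ with $A_1f=(Af)\chi_{(0,1)}$ for $f\in L^2[0,1]$; in particular $\mathcal{C}_1$ is the Cesàro operator on $L^2[0,1]$. Let $\overline{\mathbb{D}}+1=\{z\in\mathbb{C}:|z-1|\le 1\}$. For $F$ holomorphic in a neighborhood of $\overline{\mathbb{D}}+1$, the operator $F(\mathcal{C}_1)$ is defined by the holomorphic functional calculus, $$F(\mathcal{C}_1)=\frac1{2\pi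 i}\oint_{\Gamma}F(\lambda)(\lambda I-\mathcal{C}_1)^{-1}d\lambda,$$ where $\Gamma$ is the positively oriented boundary of any open disc that contains the spectrum of $\mathcal{C}_1$ and whose closure has a neighborhood in which $F$ is holomorphic (such discs exist and the integral does not depend on the choice). Finally, let $(\mathcal{M}K)(z)=\int_0^\infty K(u)u^{z-1}\,du$ be the Mellin transform. For functions $K$ and $F$ consider the conditions (a) $K(u)=0$ for a.e. $u<0$; (b) $K(u)u^{-1/2}\in L^1(\mathbb{R}_+)$; (c) $(\mathcal{M}K)(z)=F(z^{-1})$ for all $z\in\mathbb{C}$ with $\operatorname{Re}z=\frac12$. **Theorem.** Let $F$ be holomorphic in a neighborhood of the closed disc $\overline{\mathbb{D}}+1$. If $F(0)=0$, then there is a function $K$ satisfying (a), (b) and (c) such that $F(\mathcal{C}_1)=(\mathcal{H}_K)_1$. Conversely, if a function $K$ satisfies (a), (b) and (c), then $F(0)=0$ and $(\mathcal{H}_K)_1=F(\mathcal{C}_1)$. -/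

import Mathlib

open MeasureTheory Set Filter Topology
open scoped ENNReal NNReal

namespace CesaroCalculus

/-- The complex Hilbert space `L²(ℝ)` (Lebesgue measure). -/
abbrev L2R : Type := Lp ℂ 2 (volume : Measure ℝ)

/-! ### Boundedness of Hausdorff operators (helper facts) -/

/-- A Minkowski type estimate for dilation averages. -/
theorem lintegral_dilation_sq_le (k f : ℝ → ℝ≥0∞) (hk : AEMeasurable k volume)
    (hf : Measurable f) :
    ∫⁻ x : ℝ, (∫⁻ u : ℝ, k u * f (u * x)) ^ (2 : ℝ) ≤
      (∫⁻ u : ℝ, k u * ENNReal.ofReal (|u| ^ (-(1 / 2) : ℝ))) ^ (2 : ℝ) *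
        ∫⁻ x : ℝ, f x ^ (2 : ℝ) := by
  set w : ℝ → ℝ≥0∞ := fun u => ENNReal.ofReal (|u| ^ (-(1 / 2) : ℝ)) with hw
  set v : ℝ → ℝ≥0∞ := fun u => ENNReal.ofReal (|u| ^ ((1 / 2) : ℝ)) with hv
  have hwm : Measurable w := by simp only [hw]; fun_prop
  have hvm : Measurable v := by simp only [hv]; fun_prop
  have hne : ∀ᵐ u : ℝ, u ≠ 0 := by simp [ae_iff]
  have hwv : ∀ u : ℝ, u ≠ 0 → w u * v u = 1 := by
    intro u hu
    simp only [hw, hv]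
    rw [← ENNReal.ofReal_mul (by positivity), ← Real.rpow_add (abs_pos.mpr hu)]
    norm_num
  have hvv : ∀ u : ℝ, v u ^ (2 : ℝ) = ENNReal.ofReal |u| := by
    intro u
    simp only [hv]
    rw [ENNReal.ofReal_rpow_of_nonneg (by positivity) (by norm_num),
      ← Real.rpow_mul (abs_nonneg u)]
    norm_num
  have hκ : AEMeasurable (fun u => k u * w u) volume := hk.mul hwm.aemeasurable
  set A : ℝ≥0∞ := ∫⁻ u : ℝ, k u * w u with hA
  have hpt : ∀ x : ℝ, (∫⁻ u : ℝ, k u * f (u * x)) ^ (2 : ℝ) ≤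
      A * ∫⁻ u : ℝ, (k u * w u) * (ENNReal.ofReal |u| * f (u * x) ^ (2 : ℝ)) := by
    intro x
    have h1 : ∫⁻ u : ℝ, k u * f (u * x) =
        ∫⁻ u : ℝ, ((fun u => (k u * w u) ^ (1 / 2 : ℝ)) *
          (fun u => (k u * w u) ^ (1 / 2 : ℝ) * (v u * f (u * x)))) u := by
      apply lintegral_congr_ae
      filter_upwards [hne] with u hu
      simp only [Pi.mul_apply]
      rw [← mul_assoc, ← ENNReal.rpow_add_of_nonneg _ _ (by norm_num) (by norm_num)]
      norm_num
      rw [mul_assoc (k u), ← mul_assoc (w u), hwv u hu, one_mul]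
    have h2 := ENNReal.lintegral_mul_le_Lp_mul_Lq (volume : Measure ℝ)
      (p := 2) (q := 2) (by constructor <;> norm_num)
      (f := fun u => (k u * w u) ^ (1 / 2 : ℝ))
      (g := fun u => (k u * w u) ^ (1 / 2 : ℝ) * (v u * f (u * x)))
      (hκ.pow_const _)
      ((hκ.pow_const _).mul (hvm.mul (hf.comp (measurable_id.mul_const x))).aemeasurable)
    rw [← h1] at h2
    have h3 := ENNReal.rpow_le_rpow h2 (show (0 : ℝ) ≤ 2 by norm_num)
    refine h3.trans (le_of_eq ?_)
    rw [ENNReal.mul_rpow_of_nonneg _ _ (by norm_num), ← ENNReal.rpow_mul, ← ENNReal.rpow_mul]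
    norm_num only [ENNReal.rpow_one]
    congr 1
    · apply lintegral_congr
      intro u
      rw [← ENNReal.rpow_mul]; norm_num
    · apply lintegral_congr
      intro u
      rw [ENNReal.mul_rpow_of_nonneg _ _ (show (0 : ℝ) ≤ 2 by norm_num),
        ENNReal.mul_rpow_of_nonneg (v u) _ (show (0 : ℝ) ≤ 2 by norm_num), hvv,
        ← ENNReal.rpow_mul]
      norm_num
  have hscale : ∀ u : ℝ, u ≠ 0 →
      ENNReal.ofReal |u| * ∫⁻ x : ℝ, f (u * x) ^ (2 : ℝ) = ∫⁻ x : ℝ, f x ^ (2 : ℝ) := by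
    intro u hu
    have hfm : Measurable fun x => f x ^ (2 : ℝ) := hf.pow_const _
    conv_rhs => rw [← Real.smul_map_volume_mul_left hu]
    rw [lintegral_smul_measure, lintegral_map hfm (measurable_const_mul u), smul_eq_mul]
  calc ∫⁻ x : ℝ, (∫⁻ u : ℝ, k u * f (u * x)) ^ (2 : ℝ)
      ≤ ∫⁻ x : ℝ, A * ∫⁻ u : ℝ, (k u * w u) * (ENNReal.ofReal |u| * f (u * x) ^ (2 : ℝ)) :=
        lintegral_mono hpt
    _ = A * ∫⁻ x : ℝ, ∫⁻ u : ℝ, (k u * w u) * (ENNReal.ofReal |u| * f (u * x) ^ (2 : ℝ)) := by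
        apply lintegral_const_mul''
        apply AEMeasurable.lintegral_prod_right' (f := fun p : ℝ × ℝ =>
          (k p.2 * w p.2) * (ENNReal.ofReal |p.2| * f (p.2 * p.1) ^ (2 : ℝ)))
        exact hκ.comp_snd.mul (by fun_prop)
    _ = A * ∫⁻ u : ℝ, ∫⁻ x : ℝ, (k u * w u) * (ENNReal.ofReal |u| * f (u * x) ^ (2 : ℝ)) := by
        congr 1
        apply lintegral_lintegral_swap
        exact hκ.comp_snd.mul (by fun_prop)
    _ = A * ∫⁻ u : ℝ, (k u * w u) * ∫⁻ x : ℝ, f x ^ (2 : ℝ) := by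
        congr 1
        apply lintegral_congr_ae
        filter_upwards [hne] with u hu
        rw [← hscale u hu, lintegral_const_mul _ (by fun_prop), lintegral_const_mul _ (by fun_prop)]
    _ = A ^ (2 : ℝ) * ∫⁻ x : ℝ, f x ^ (2 : ℝ) := by
        rw [lintegral_mul_const'' _ hκ, ← mul_assoc]
        congr 1
        rw [show (2 : ℝ) = ((2 : ℕ) : ℝ) by norm_num, ENNReal.rpow_natCast, sq]

/-- The condition `K(u)|u|^{-1/2} ∈ L¹(ℝ)` under which Hausdorff operators are considered. -/
def AdmissibleKernel (K : ℝ → ℂ) : Prop :=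
  Integrable (fun u : ℝ => K u * ((|u| ^ (-(1 / 2) : ℝ) : ℝ) : ℂ)) volume

theorem AdmissibleKernel.aestronglyMeasurable {K : ℝ → ℂ} (hK : AdmissibleKernel K) :
    AEStronglyMeasurable K volume := by
  have hne : ∀ᵐ u : ℝ, u ≠ 0 := by simp [ae_iff]
  have h1 : AEStronglyMeasurable (fun u : ℝ => ((|u| ^ ((1 / 2) : ℝ) : ℝ) : ℂ)) volume := by
    have : Measurable (fun u : ℝ => ((|u| ^ ((1 / 2) : ℝ) : ℝ) : ℂ)) := by fun_prop
    exact this.aestronglyMeasurable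
  refine (hK.1.mul h1).congr ?_
  filter_upwards [hne] with u hu
  simp only [Pi.mul_apply]
  rw [mul_assoc, ← Complex.ofReal_mul, ← Real.rpow_add (abs_pos.mpr hu)]
  norm_num

theorem AdmissibleKernel.aestronglyMeasurable_prod {K : ℝ → ℂ} (hK : AdmissibleKernel K)
    (f : L2R) :
    AEStronglyMeasurable (fun p : ℝ × ℝ => K p.2 * f (p.2 * p.1))
      ((volume : Measure ℝ).prod volume) := by
  refine hK.aestronglyMeasurable.comp_snd.mul ?_
  exact ((Lp.stronglyMeasurable f).comp_measurable
    (measurable_snd.mul measurable_fst)).aestronglyMeasurable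

theorem lintegral_enorm_sq (f : ℝ → ℂ) :
    (∫⁻ x : ℝ, ‖f x‖ₑ ^ (2 : ℝ)) = eLpNorm f 2 volume ^ (2 : ℝ) := by
  rw [eLpNorm_eq_lintegral_rpow_enorm_toReal (by norm_num) (by norm_num), ← ENNReal.rpow_mul]
  norm_num

/-- The bound of the Hausdorff operator with kernel `K`. -/
noncomputable def kernelBound (K : ℝ → ℂ) : ℝ :=
  ∫ u : ℝ, ‖K u * ((|u| ^ (-(1 / 2) : ℝ) : ℝ) : ℂ)‖

theorem AdmissibleKernel.lintegral_sq_le {K : ℝ → ℂ} (hK : AdmissibleKernel K) (f : L2R) :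
    ∫⁻ x : ℝ, (∫⁻ u : ℝ, ‖K u * f (u * x)‖ₑ) ^ (2 : ℝ) ≤
      (ENNReal.ofReal (kernelBound K) * eLpNorm f 2 volume) ^ (2 : ℝ) := by
  have h := lintegral_dilation_sq_le (fun u => ‖K u‖ₑ) (fun x => ‖f x‖ₑ)
    hK.aestronglyMeasurable.enorm (Lp.stronglyMeasurable f).enorm
  simp only [enorm_mul]
  refine h.trans (le_of_eq ?_)
  rw [ENNReal.mul_rpow_of_nonneg _ _ (by norm_num), lintegral_enorm_sq, kernelBound,
    ofReal_integral_norm_eq_lintegral_enorm hK]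
  congr 2
  apply lintegral_congr
  intro u
  rw [enorm_mul]
  congr 1
  rw [← ofReal_norm, Complex.norm_real, Real.norm_of_nonneg (by positivity)]

theorem AdmissibleKernel.eLpNorm_le {K : ℝ → ℂ} (hK : AdmissibleKernel K) (f : L2R) :
    eLpNorm (fun x : ℝ => ∫ u : ℝ, K u * f (u * x)) 2 volume ≤
      ENNReal.ofReal (kernelBound K) * eLpNorm f 2 volume := by
  rw [← ENNReal.rpow_le_rpow_iff (show (0 : ℝ) < 2 by norm_num), ← lintegral_enorm_sq]
  refine le_trans (lintegral_mono fun x => ?_) (hK.lintegral_sq_le f)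
  exact ENNReal.rpow_le_rpow (enorm_integral_le_lintegral_enorm _) (by norm_num)

theorem AdmissibleKernel.memLp {K : ℝ → ℂ} (hK : AdmissibleKernel K) (f : L2R) :
    MemLp (fun x : ℝ => ∫ u : ℝ, K u * f (u * x)) 2 volume :=
  ⟨(hK.aestronglyMeasurable_prod f).integral_prod_right',
    (hK.eLpNorm_le f).trans_lt (ENNReal.mul_lt_top ENNReal.ofReal_lt_top (Lp.memLp f).2)⟩

theorem AdmissibleKernel.ae_integrable {K : ℝ → ℂ} (hK : AdmissibleKernel K) (f : L2R) :
    ∀ᵐ x : ℝ, Integrable (fun u : ℝ => K u * f (u * x)) volume := by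
  have hm := hK.aestronglyMeasurable_prod f
  have hfin : (∫⁻ x : ℝ, (∫⁻ u : ℝ, ‖K u * f (u * x)‖ₑ) ^ (2 : ℝ)) ≠ ∞ :=
    ((hK.lintegral_sq_le f).trans_lt (ENNReal.rpow_lt_top_of_nonneg (by norm_num)
      (ENNReal.mul_lt_top ENNReal.ofReal_lt_top (Lp.memLp f).2).ne)).ne
  have hmeas : AEMeasurable (fun x : ℝ => (∫⁻ u : ℝ, ‖K u * f (u * x)‖ₑ) ^ (2 : ℝ)) volume :=
    (hm.enorm.lintegral_prod_right').pow_const _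
  filter_upwards [ae_lt_top' hmeas hfin, hm.prodMk_left] with x hx hx'
  refine ⟨hx', ?_⟩
  exact (ENNReal.rpow_lt_top_iff_of_pos (by norm_num)).1 hx

theorem ae_comp_dilation {p : ℝ → Prop} (h : ∀ᵐ x : ℝ, p x) {x : ℝ} (hx : x ≠ 0) :
    ∀ᵐ u : ℝ, p (u * x) := by
  have hq : Measure.QuasiMeasurePreserving (fun u : ℝ => u * x) volume volume := by
    refine ⟨measurable_id.mul_const x, ?_⟩
    rw [Real.map_volume_mul_right hx]
    exact Measure.smul_absolutelyContinuous
  exact hq.ae h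

/-! ### Hausdorff operators and the Cesàro operator on `L²(ℝ)` -/

/-- The Hausdorff operator `(𝓗_K f)(x) = ∫_ℝ K(u) f(ux) du` as a bounded operator on `L²(ℝ)`. -/
noncomputable def hausdorffOp (K : ℝ → ℂ) (hK : AdmissibleKernel K) : L2R →L[ℂ] L2R :=
  LinearMap.mkContinuous
    { toFun := fun f => (hK.memLp f).toLp (fun x : ℝ => ∫ u : ℝ, K u * f (u * x))
      map_add' := by
        intro f g
        rw [← MemLp.toLp_add, MemLp.toLp_eq_toLp_iff]
        have hne : ∀ᵐ x : ℝ, x ≠ 0 := by simp [ae_iff]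
        filter_upwards [hne, hK.ae_integrable f, hK.ae_integrable g] with x hx hf hg
        simp only [Pi.add_apply]
        rw [← integral_add hf hg]
        apply integral_congr_ae
        filter_upwards [ae_comp_dilation (Lp.coeFn_add f g) hx] with u hu
        rw [hu, Pi.add_apply, mul_add]
      map_smul' := by
        intro c f
        rw [RingHom.id_apply, ← MemLp.toLp_const_smul, MemLp.toLp_eq_toLp_iff]
        have hne : ∀ᵐ x : ℝ, x ≠ 0 := by simp [ae_iff]
        filter_upwards [hne] with x hx
        simp only [Pi.smul_apply]
        rw [← integral_smul]
        apply integral_congr_ae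
        filter_upwards [ae_comp_dilation (Lp.coeFn_smul c f) hx] with u hu
        rw [hu, Pi.smul_apply, smul_eq_mul, smul_eq_mul]
        ring }
    (kernelBound K)
    (by
      intro f
      have h0 : 0 ≤ kernelBound K := integral_nonneg fun _ => norm_nonneg _
      simp only [LinearMap.coe_mk, AddHom.coe_mk]
      rw [Lp.norm_toLp, Lp.norm_def, ← ENNReal.toReal_ofReal h0, ← ENNReal.toReal_mul]
      exact ENNReal.toReal_mono
        (ENNReal.mul_lt_top ENNReal.ofReal_lt_top (Lp.memLp f).2).ne (hK.eLpNorm_le f))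

/-- The kernel `χ_{(0,1)}` of the Cesàro operator. -/
noncomputable def cesaroKernel : ℝ → ℂ := (Ioo (0 : ℝ) 1).indicator fun _ => 1

theorem admissible_cesaroKernel : AdmissibleKernel cesaroKernel := by
  have h : (fun u : ℝ => cesaroKernel u * ((|u| ^ (-(1 / 2) : ℝ) : ℝ) : ℂ)) =
      (Ioo (0 : ℝ) 1).indicator fun u => ((u ^ (-(1 / 2) : ℝ) : ℝ) : ℂ) := by
    ext u
    by_cases hu : u ∈ Ioo (0 : ℝ) 1
    · simp [cesaroKernel, hu, abs_of_pos hu.1]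
    · simp [cesaroKernel, hu]
  rw [AdmissibleKernel, h, integrable_indicator_iff measurableSet_Ioo]
  apply Integrable.ofReal
  exact (intervalIntegral.integrableOn_Ioo_rpow_iff (by norm_num)).2 (by norm_num)

/-- The Cesàro operator `(𝓒 f)(x) = (1/x) ∫_0^x f(t) dt = ∫_0^1 f(ux) du` on `L²(ℝ)`. -/
noncomputable def cesaro : L2R →L[ℂ] L2R := hausdorffOp cesaroKernel admissible_cesaroKernel

/-- The two expressions of the Cesàro operator agree. -/
theorem cesaro_ae_eq (f : L2R) :
    cesaro f =ᵐ[volume] fun x : ℝ => (x : ℂ)⁻¹ * ∫ t in (0 : ℝ)..x, f t := by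
  have hne : ∀ᵐ x : ℝ, x ≠ 0 := by simp [ae_iff]
  filter_upwards [hne, (admissible_cesaroKernel.memLp f).coeFn_toLp] with x hx h
  refine h.trans ?_
  have h1 : (fun u : ℝ => cesaroKernel u * f (u * x)) =
      (Ioo (0 : ℝ) 1).indicator fun u => f (u * x) := by
    ext u
    by_cases hu : u ∈ Ioo (0 : ℝ) 1 <;> simp [cesaroKernel, hu]
  rw [h1, integral_indicator measurableSet_Ioo, ← integral_Ioc_eq_integral_Ioo,
    ← intervalIntegral.integral_of_le zero_le_one,
    intervalIntegral.integral_comp_mul_right (fun t => f t) hx]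
  simp

/-- A kernel vanishing on the negative half-line with `K(u) u^{-1/2} ∈ L¹(ℝ₊)` is admissible. -/
theorem admissible_of_halfLine {K : ℝ → ℂ} (ha : ∀ᵐ u : ℝ, u < 0 → K u = 0)
    (hb : IntegrableOn (fun u : ℝ => K u * ((u ^ (-(1 / 2) : ℝ) : ℝ) : ℂ)) (Ioi 0) volume) :
    AdmissibleKernel K := by
  rw [AdmissibleKernel]
  refine (hb.integrable_indicator measurableSet_Ioi).congr ?_
  have hne : ∀ᵐ u : ℝ, u ≠ 0 := by simp [ae_iff]
  filter_upwards [ha, hne] with u hu hu0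
  rcases lt_or_gt_of_ne hu0 with h | h
  · simp [hu h, indicator, h.not_gt]
  · simp [indicator, h, abs_of_pos h]

/-! ### The subspace `L²[0,1]` and bi-restrictions -/

/-- `L²[0,1]` as the subspace of those `f ∈ L²(ℝ)` which vanish a.e. outside `[0,1]`. -/
def L2I : Submodule ℂ L2R where
  carrier := {f | ∀ᵐ x : ℝ, x ∉ Icc (0 : ℝ) 1 → f x = 0}
  zero_mem' := by
    filter_upwards [Lp.coeFn_zero ℂ 2 (volume : Measure ℝ)] with x hx _
    rw [hx, Pi.zero_apply]
  add_mem' := by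
    intro f g hf hg
    filter_upwards [hf, hg, Lp.coeFn_add f g] with x h1 h2 h3 hx
    rw [h3, Pi.add_apply, h1 hx, h2 hx, add_zero]
  smul_mem' := by
    intro c f hf
    filter_upwards [hf, Lp.coeFn_smul c f] with x h1 h2 hx
    rw [h2, Pi.smul_apply, h1 hx, smul_zero]

/-- The map `f ↦ f χ_{(0,1)}` from `L²(ℝ)` to `L²[0,1]`. -/
noncomputable def truncate : L2R →L[ℂ] L2I :=
  LinearMap.mkContinuous
    { toFun := fun f => ⟨((Lp.memLp f).indicator measurableSet_Ioo).toLp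
          ((Ioo (0 : ℝ) 1).indicator f), by
        filter_upwards [((Lp.memLp f).indicator
          (measurableSet_Ioo (a := (0 : ℝ)) (b := 1))).coeFn_toLp] with x hx hx'
        rw [hx]
        exact indicator_of_notMem (fun h => hx' (Ioo_subset_Icc_self h)) _⟩
      map_add' := by
        intro f g
        apply Subtype.ext
        simp only [Submodule.coe_add]
        rw [← MemLp.toLp_add, MemLp.toLp_eq_toLp_iff]
        filter_upwards [Lp.coeFn_add f g] with x hx
        by_cases h : x ∈ Ioo (0 : ℝ) 1
        · simp only [indicator_of_mem h, hx, Pi.add_apply]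
        · simp only [indicator_of_notMem h, Pi.add_apply, add_zero]
      map_smul' := by
        intro c f
        apply Subtype.ext
        simp only [Submodule.coe_smul, RingHom.id_apply]
        rw [← MemLp.toLp_const_smul, MemLp.toLp_eq_toLp_iff]
        filter_upwards [Lp.coeFn_smul c f] with x hx
        by_cases h : x ∈ Ioo (0 : ℝ) 1
        · simp only [indicator_of_mem h, hx, Pi.smul_apply]
        · simp only [indicator_of_notMem h, Pi.smul_apply, smul_zero] }
    1
    (by
      intro f
      rw [one_mul]
      change ‖((Lp.memLp f).indicator measurableSet_Ioo).toLp
        ((Ioo (0 : ℝ) 1).indicator f)‖ ≤ ‖f‖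
      rw [Lp.norm_toLp, Lp.norm_def]
      exact ENNReal.toReal_mono (Lp.memLp f).2.ne (eLpNorm_indicator_le _))

theorem truncate_of_mem (f : L2I) : truncate (f : L2R) = f := by
  apply Subtype.ext
  apply Lp.ext
  have h0 : ∀ᵐ x : ℝ, x ≠ 0 := by simp [ae_iff]
  have h1 : ∀ᵐ x : ℝ, x ≠ 1 := by simp [ae_iff]
  have hf : ∀ᵐ x : ℝ, x ∉ Icc (0 : ℝ) 1 → (f : L2R) x = 0 := f.2
  refine (((Lp.memLp (f : L2R)).indicator
    (measurableSet_Ioo (a := (0 : ℝ)) (b := 1))).coeFn_toLp).trans ?_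
  filter_upwards [h0, h1, hf] with x hx0 hx1 hx
  by_cases h : x ∈ Ioo (0 : ℝ) 1
  · exact indicator_of_mem h _
  · rw [indicator_of_notMem h, hx]
    intro h'
    exact h ⟨lt_of_le_of_ne h'.1 (Ne.symm hx0), lt_of_le_of_ne h'.2 hx1⟩

/-- `L²[0,1]` is complete. -/
instance : CompleteSpace L2I := by
  have h : (L2I : Set L2R) = {f | ((truncate f : L2I) : L2R) = f} := by
    ext f
    constructor
    · intro hf
      exact congrArg Subtype.val (truncate_of_mem ⟨f, hf⟩)
    · intro hf
      have hf' : ((truncate f : L2I) : L2R) = f := hf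
      rw [← hf']
      exact (truncate f).2
  have hc : IsClosed (L2I : Set L2R) := by
    rw [h]
    exact isClosed_eq (continuous_subtype_val.comp truncate.continuous) continuous_id
  exact hc.completeSpace_coe

/-- The bi-restriction `A₁` to `L²[0,1]` of an operator `A` on `L²(ℝ)`:
`A₁ f = (A f) χ_{(0,1)}` for `f ∈ L²[0,1]`. -/
noncomputable def biRestrict (A : L2R →L[ℂ] L2R) : L2I →L[ℂ] L2I :=
  truncate.comp (A.comp L2I.subtypeL)

/-- The Cesàro operator on `L²[0,1]`. -/
noncomputable def cesaroI : L2I →L[ℂ] L2I := biRestrict cesaro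

/-! ### Holomorphic functional calculus -/

/-- The Riesz–Dunford integral `(1/2πi) ∫_Γ F(λ) (λ - A)⁻¹ dλ` over the positively oriented
circle `Γ` with centre `c` and radius `R`. -/
noncomputable def dunfordIntegral {E : Type*} [NormedAddCommGroup E] [NormedSpace ℂ E]
    (F : ℂ → ℂ) (A : E →L[ℂ] E) (c : ℂ) (R : ℝ) : E →L[ℂ] E :=
  (2 * (Real.pi : ℂ) * Complex.I)⁻¹ • ∮ z in C(c, R), F z • resolvent A z

/-- `B = F(A)` in the sense of the holomorphic functional calculus, for functions `F` holomorphic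
near a closed disc whose interior contains the spectrum of `A`: such discs exist, and for each of
them `B` is the Riesz–Dunford integral of `F` over the boundary of the disc. -/
def IsHolomorphicFunctionOf {E : Type*} [NormedAddCommGroup E] [NormedSpace ℂ E]
    (F : ℂ → ℂ) (A B : E →L[ℂ] E) : Prop :=
  (∃ (c : ℂ) (R : ℝ), 0 < R ∧ spectrum ℂ A ⊆ Metric.ball c R ∧
      AnalyticOnNhd ℂ F (Metric.closedBall c R)) ∧
    ∀ (c : ℂ) (R : ℝ), 0 < R → spectrum ℂ A ⊆ Metric.ball c R →
      AnalyticOnNhd ℂ F (Metric.closedBall c R) → B = dunfordIntegral F A c R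

end CesaroCalculus

namespace CesaroCalculus

open scoped FourierTransform ContDiff

/-! ### Uniqueness of Fourier and Mellin transforms -/

/-! The monomials diagonalise everything. If `K` vanishes off `(0,1]`, then `x^n` is an eigenvector
of the bi-restricted Hausdorff operator with eigenvalue `(𝓜K)(n+1)`; in particular the Cesàro
operator has eigenvalue `1/(n+1)`, and the Dunford integral acts on `x^n` as `F(1/(n+1))`.
Polynomials are dense in `L²[0,1]`, so the two operators agree as soon as `(𝓜K)(z) = F(1/z)` at the
positive integers (`ext_on_monomials`).

A suitable kernel comes from Cauchy's formula on `|w-1| = r` with `r > 1` slightly: `F(1/z) - F(0)`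
is `(1/2πi) ∮ F(w) w⁻² (z - 1/w)⁻¹ dw`, and `(z - 1/w)⁻¹ = ∫₀¹ u^(z-1-1/w) du` because `Re(1/w) <
1/2 ≤ Re z` on the circle (`mellin_cauchyKernel`). This gives the identity on the whole half-plane,
with a kernel supported in `(0,1]`.

An arbitrary `K` is controlled only on `Re z = 1/2`. There the Mellin transform is a Fourier
transform: Riemann–Lebesgue forces `F(0) = 0`, and injectivity identifies `K` a.e. with the Cauchy
kernel (`ae_eq_of_mellin_eq`). The spectrum lies in the closed disc because `‖𝓒₁ - 1‖ ≤ 1`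
(`norm_cesaroI_sub_one_le`). -/

theorem ae_eq_zero_of_fourier_eq_zero {f : ℝ → ℂ} (hf : Integrable f) (h : ∀ ξ, 𝓕 f ξ = 0) :
    ∀ᵐ x, f x = 0 := by
  refine ae_eq_zero_of_integral_contDiff_smul_eq_zero hf.locallyIntegrable fun g hg hgs => ?_
  have hg' : ContDiff ℝ ∞ fun x => (g x : ℂ) := Complex.ofRealCLM.contDiff.comp hg
  have hgs' : HasCompactSupport fun x => (g x : ℂ) := hgs.comp_left Complex.ofReal_zero
  -- The test function is written as `𝓕 φ`, so the multiplication formula turns its pairing with `f`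
  -- into a pairing of `φ` with `𝓕 f = 0`.
  set φ : SchwartzMap ℝ ℂ := 𝓕⁻ (hgs'.toSchwartzMap hg') with hφ
  have h1 : 𝓕 φ = hgs'.toSchwartzMap hg' := FourierTransform.fourier_fourierInv_eq _
  have h2 : ∫ ξ, 𝓕 f ξ • φ ξ = ∫ x, f x • 𝓕 (φ : ℝ → ℂ) x := by
    simpa using! VectorFourier.integral_fourierIntegral_smul_eq_flip (L := innerₗ ℝ)
      Real.continuous_fourierChar continuous_inner hf φ.integrable
  simp only [h, zero_smul, integral_zero, ← SchwartzMap.fourier_coe, h1] at h2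
  rw [h2]
  congr 1 with x
  simp [mul_comm]

/-- The substitution `u = e^{-t}`, normalised on the critical line. -/
noncomputable def expPullback (K : ℝ → ℂ) (t : ℝ) : ℂ :=
  Real.exp (-(1 / 2) * t) • K (Real.exp (-t))

theorem hasDerivWithinAt_exp_neg (x : ℝ) (_ : x ∈ univ) :
    HasDerivWithinAt (fun t => Real.exp (-t)) (-Real.exp (-x)) univ x := by
  have h := (hasDerivAt_neg x).exp
  rw [mul_neg_one] at h
  exact h.hasDerivWithinAt

theorem exp_neg_image : (fun t => Real.exp (-t)) '' univ = Ioi 0 := by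
  ext y
  simp only [image_univ, mem_range, mem_Ioi]
  exact ⟨fun ⟨t, ht⟩ => ht ▸ Real.exp_pos _, fun hy => ⟨-Real.log y, by simp [Real.exp_log hy]⟩⟩

theorem exp_neg_injOn : InjOn (fun t => Real.exp (-t)) univ := fun x _ y _ h => by
  simpa using h

/-- Under `u = e^{-t}` the weight `u^{-1/2}` becomes `e^{t/2}`; with the Jacobian `e^{-t}` this
leaves the factor `e^{-t/2}`. -/
theorem integrable_expPullback {K : ℝ → ℂ}
    (hb : IntegrableOn (fun u : ℝ => K u * ((u ^ (-(1 / 2) : ℝ) : ℝ) : ℂ)) (Ioi 0) volume) :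
    Integrable (expPullback K) := by
  rw [← exp_neg_image, integrableOn_image_iff_integrableOn_abs_deriv_smul MeasurableSet.univ
    hasDerivWithinAt_exp_neg exp_neg_injOn, integrableOn_univ] at hb
  refine hb.congr (ae_of_all _ fun t => ?_)
  simp only [expPullback, abs_neg, Real.abs_exp, Complex.real_smul]
  rw [mul_comm (K _), ← mul_assoc, ← Complex.ofReal_mul, ← Real.exp_mul, ← Real.exp_add]
  ring_nf

/-- The imaginary part `2πξ` matches the normalisation of `𝓕`. -/
theorem mellin_critical_line (K : ℝ → ℂ) (ξ : ℝ) :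
    mellin K (1 / 2 + 2 * Real.pi * ξ * Complex.I) = 𝓕 (expPullback K) ξ := by
  rw [mellin_eq_fourier]
  have h1 : (1 / 2 + 2 * Real.pi * ξ * Complex.I : ℂ).re = 1 / 2 := by simp
  have h2 : (1 / 2 + 2 * Real.pi * ξ * Complex.I : ℂ).im / (2 * Real.pi) = ξ := by
    have := Real.pi_pos
    simp
  rw [h1, h2]
  rfl

theorem ae_eq_zero_of_expPullback {K : ℝ → ℂ} (hK : AEStronglyMeasurable K volume)
    (h : ∀ᵐ t, expPullback K t = 0) : ∀ᵐ u : ℝ, 0 < u → K u = 0 := by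
  -- The a.e. statement is carried across the substitution by the vanishing of a nonnegative
  -- integral.
  have h1 : ∫⁻ u in Ioi 0, ‖K u‖ₑ = 0 := by
    rw [← exp_neg_image, lintegral_image_eq_lintegral_abs_deriv_mul MeasurableSet.univ
      hasDerivWithinAt_exp_neg exp_neg_injOn, Measure.restrict_univ]
    rw [lintegral_congr_ae (g := fun _ => 0), lintegral_zero]
    filter_upwards [h] with t ht
    rw [expPullback, smul_eq_zero] at ht
    simp [ht.resolve_left (Real.exp_pos _).ne']
  rw [lintegral_eq_zero_iff' hK.enorm.restrict] at h1
  filter_upwards [(ae_restrict_iff' measurableSet_Ioi).1 h1] with u hu hu'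
  simpa using hu hu'

theorem expPullback_sub (K L : ℝ → ℂ) :
    expPullback (K - L) = expPullback K - expPullback L := by
  ext t
  simp [expPullback, mul_sub]

/-- A kernel on the half-line is determined by its Mellin transform on the critical line. -/
theorem ae_eq_of_mellin_eq {K L : ℝ → ℂ}
    (haK : ∀ᵐ u : ℝ, u < 0 → K u = 0) (haL : ∀ᵐ u : ℝ, u < 0 → L u = 0)
    (hbK : IntegrableOn (fun u : ℝ => K u * ((u ^ (-(1 / 2) : ℝ) : ℝ) : ℂ)) (Ioi 0) volume)
    (hbL : IntegrableOn (fun u : ℝ => L u * ((u ^ (-(1 / 2) : ℝ) : ℝ) : ℂ)) (Ioi 0) volume)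
    (h : ∀ z : ℂ, z.re = 1 / 2 → mellin K z = mellin L z) : K =ᵐ[volume] L := by
  have hKL : ∀ᵐ t, expPullback (K - L) t = 0 := by
    rw [expPullback_sub]
    refine ae_eq_zero_of_fourier_eq_zero
      ((integrable_expPullback hbK).sub (integrable_expPullback hbL)) fun ξ => ?_
    have h1 := h (1 / 2 + 2 * Real.pi * ξ * Complex.I) (by simp)
    rw [mellin_critical_line, mellin_critical_line] at h1
    rw [Real.fourier_eq] at h1 ⊢
    rw [Real.fourier_eq] at h1
    simp only [Pi.sub_apply, smul_sub]
    rw [integral_sub, h1, sub_self]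
    · exact (Real.fourierIntegral_convergent_iff ξ).2 (integrable_expPullback hbK)
    · exact (Real.fourierIntegral_convergent_iff ξ).2 (integrable_expPullback hbL)
  have hm := (admissible_of_halfLine haK hbK).aestronglyMeasurable.sub
    (admissible_of_halfLine haL hbL).aestronglyMeasurable
  have hne : ∀ᵐ u : ℝ, u ≠ 0 := by simp [ae_iff]
  filter_upwards [haK, haL, hne, ae_eq_zero_of_expPullback hm hKL] with u h1 h2 h3 h4
  rcases lt_or_gt_of_ne h3 with h5 | h5
  · rw [h1 h5, h2 h5]
  · exact sub_eq_zero.1 (h4 h5)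

/-- If `F(1/z)` is a Mellin transform on the critical line, then `F` vanishes at the origin. -/
theorem eq_zero_of_mellin_eq {K : ℝ → ℂ} {F : ℂ → ℂ} (hF : ContinuousAt F 0)
    (h : ∀ z : ℂ, z.re = 1 / 2 → mellin K z = F z⁻¹) : F 0 = 0 := by
  -- Riemann–Lebesgue. Along the critical line `1/z → 0`, so the same function also tends to `F 0`.
  have h1 : Tendsto (𝓕 (expPullback K)) atTop (𝓝 0) :=
    (Real.zero_at_infty_fourier _).mono_left atTop_le_cocompact
  have h2 : Tendsto (fun ξ : ℝ => (1 / 2 + 2 * Real.pi * ξ * Complex.I : ℂ)) atTop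
      (Bornology.cobounded ℂ) := by
    rw [← tendsto_norm_atTop_iff_cobounded]
    refine tendsto_atTop_mono (f := fun ξ : ℝ => 2 * Real.pi * ξ) (fun ξ => ?_)
      (tendsto_id.const_mul_atTop (by positivity))
    refine le_trans (le_of_eq ?_) ((le_abs_self _).trans (Complex.abs_im_le_norm _))
    simp
  have h3 : Tendsto (𝓕 (expPullback K)) atTop (𝓝 (F 0)) := by
    refine ((hF.tendsto.comp tendsto_inv₀_cobounded).comp h2).congr fun ξ => ?_
    rw [← mellin_critical_line, h _ (by simp)]
    rfl
  exact tendsto_nhds_unique h3 h1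

/-! ### The kernel attached to a holomorphic function -/

/-- After multiplying by `|z|²` this is `|1 - z|² ≤ |z|²`, that is `1 ≤ 2 Re z`. -/
theorem inv_mem_closedBall {z : ℂ} (hz : 1 / 2 ≤ z.re) : z⁻¹ ∈ Metric.closedBall (1 : ℂ) 1 := by
  have hz0 : z ≠ 0 := by
    rintro rfl
    norm_num at hz
  rw [mem_closedBall_iff_norm, show z⁻¹ - 1 = (1 - z) / z by field_simp, norm_div,
    div_le_one (norm_pos_iff.2 hz0), ← sq_le_sq₀ (norm_nonneg _) (norm_nonneg _),
    Complex.sq_norm, Complex.sq_norm, Complex.normSq_apply, Complex.normSq_apply]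
  simp
  nlinarith

/-- On the circle `|w|² = r² - 1 + 2 Re w`, and the bound reduces to `Re w ≤ 1 + r`. As `(1 + r)⁻¹ <
1/2`, it leaves room for integrability of `u^(z-1-1/w)` up to and including the critical line. -/
theorem re_inv_le_of_mem_sphere {r : ℝ} (hr : 1 < r) {w : ℂ} (hw : w ∈ Metric.sphere (1 : ℂ) r) :
    (w⁻¹).re ≤ (1 + r)⁻¹ := by
  rw [mem_sphere_iff_norm] at hw
  have h0 : w ≠ 0 := by
    rintro rfl
    norm_num at hw
    linarith
  have h1 : Complex.normSq (w - 1) = r ^ 2 := by rw [← hw, Complex.sq_norm]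
  have h2 : w.re ≤ 1 + r := by
    have := Complex.re_le_norm (w - 1)
    rw [hw] at this
    simp at this
    linarith
  have h3 : Complex.normSq w = r ^ 2 - 1 + 2 * w.re := by
    rw [← h1, Complex.normSq_apply, Complex.normSq_apply]
    simp
    ring
  have h4 := Complex.normSq_pos.2 h0
  rw [Complex.inv_re, div_le_iff₀ h4, inv_mul_eq_div, le_div_iff₀ (by linarith), h3]
  nlinarith

/-- The kernel on `(0,1)` whose Mellin transform is `F(1/z)`, as a Cauchy integral over the circle
with centre `1` and radius `r`. -/
noncomputable def cauchyKernel (F : ℂ → ℂ) (r : ℝ) (u : ℝ) : ℂ :=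
  (Ioc (0 : ℝ) 1).indicator (fun u : ℝ => (2 * (Real.pi : ℂ) * Complex.I)⁻¹ *
    ∮ w in C(1, r), F w * (w ^ 2)⁻¹ * (u : ℂ) ^ (-w⁻¹)) u

theorem cauchyKernel_of_notMem {F : ℂ → ℂ} {r u : ℝ} (hu : u ∉ Ioc (0 : ℝ) 1) :
    cauchyKernel F r u = 0 := indicator_of_notMem hu _

theorem circleMap_one_ne_zero {r : ℝ} (hr : 1 < r) (θ : ℝ) : circleMap 1 r θ ≠ 0 := by
  intro h
  have h1 := circleMap_mem_sphere (1 : ℂ) (zero_le_one.trans hr.le) θ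
  rw [h, mem_sphere_iff_norm] at h1
  norm_num at h1
  linarith

theorem two_pi_I_inv_mul_circleIntegral {F : ℂ → ℂ} {c w : ℂ} {r : ℝ}
    (hF : AnalyticOnNhd ℂ F (Metric.closedBall c r)) (hw : w ∈ Metric.ball c r) :
    (2 * (Real.pi : ℂ) * Complex.I)⁻¹ * (∮ z in C(c, r), (z - w)⁻¹ * F z) = F w :=
  ((hF.differentiableOn.mono Metric.closure_ball_subset_closedBall).diffContOnCl
    ).two_pi_i_inv_smul_circleIntegral_sub_inv_smul hw

section

variable {F : ℂ → ℂ} {r : ℝ}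

theorem continuous_cauchyDensity (hr : 1 < r) (hF : ContinuousOn F (Metric.sphere 1 r)) :
    Continuous fun θ : ℝ => deriv (circleMap 1 r) θ *
      (F (circleMap 1 r θ) * (circleMap 1 r θ ^ 2)⁻¹) := by
  have hr0 : 0 ≤ r := zero_le_one.trans hr.le
  have h1 : Continuous fun θ : ℝ => F (circleMap 1 r θ) :=
    hF.comp_continuous (continuous_circleMap 1 r) fun θ => circleMap_mem_sphere 1 hr0 θ
  have h2 : Continuous fun θ : ℝ => (circleMap 1 r θ ^ 2)⁻¹ :=
    ((continuous_circleMap 1 r).pow 2).inv₀ fun θ => pow_ne_zero 2 (circleMap_one_ne_zero hr θ)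
  have h3 : Continuous fun θ : ℝ => deriv (circleMap 1 r) θ := by
    simp only [deriv_circleMap]
    fun_prop
  exact h3.mul (h1.mul h2)

/-- This licenses Fubini. The density in `θ` is bounded, and the power of `u` is dominated by `u^(Re
z - 1 - (1+r)⁻¹)`, whose exponent exceeds `-1`. -/
theorem integrable_mellin_cauchyIntegrand (hr : 1 < r) (hF : ContinuousOn F (Metric.sphere 1 r))
    {z : ℂ} (hz : 1 / 2 ≤ z.re) :
    Integrable (fun p : ℝ × ℝ => (deriv (circleMap 1 r) p.2 *
      (F (circleMap 1 r p.2) * (circleMap 1 r p.2 ^ 2)⁻¹)) *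
        (p.1 : ℂ) ^ (z - 1 - (circleMap 1 r p.2)⁻¹))
      ((volume.restrict (Ioc (0 : ℝ) 1)).prod (volume.restrict (Ioc 0 (2 * Real.pi)))) := by
  have hr0 : 0 ≤ r := zero_le_one.trans hr.le
  have hc := continuous_cauchyDensity hr hF
  obtain ⟨M, hM⟩ := (isCompact_Icc (a := (0 : ℝ)) (b := 2 * Real.pi)).exists_bound_of_continuousOn
    hc.continuousOn
  have hlt : (1 + r)⁻¹ < 1 / 2 := by
    rw [inv_eq_one_div]
    exact one_div_lt_one_div_of_lt (by norm_num) (by linarith)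
  have hint : Integrable (fun u : ℝ => u ^ (z.re - 1 - (1 + r)⁻¹))
      (volume.restrict (Ioc (0 : ℝ) 1)) :=
    (intervalIntegrable_iff_integrableOn_Ioc_of_le zero_le_one).1
      (intervalIntegral.intervalIntegrable_rpow' (by linarith))
  have hbound := hint.mul_prod (integrable_const (μ := volume.restrict (Ioc 0 (2 * Real.pi))) M)
  refine hbound.mono' ?_ ?_
  · refine Measurable.aestronglyMeasurable ?_
    refine (hc.measurable.comp measurable_snd).mul ?_
    exact (Complex.measurable_ofReal.comp measurable_fst).pow
      (measurable_const.sub ((measurable_circleMap 1 r).comp measurable_snd).inv)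
  · rw [Measure.prod_restrict]
    refine (ae_restrict_iff' (measurableSet_Ioc.prod measurableSet_Ioc)).2 (ae_of_all _ ?_)
    rintro ⟨u, θ⟩ ⟨hu, hθ⟩
    rw [norm_mul, mul_comm]
    refine mul_le_mul ?_ (hM θ (Ioc_subset_Icc_self hθ)) (norm_nonneg _)
      (Real.rpow_nonneg hu.1.le _)
    rw [Complex.norm_cpow_eq_rpow_re_of_pos hu.1]
    -- For `0 < u ≤ 1` the smaller exponent gives the larger power.
    refine Real.rpow_le_rpow_of_exponent_ge hu.1 hu.2 ?_
    have := re_inv_le_of_mem_sphere hr (circleMap_mem_sphere 1 hr0 θ)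
    rw [Complex.sub_re, Complex.sub_re, Complex.one_re]
    linarith

theorem cpow_mul_cauchyKernel (z : ℂ) {u : ℝ} (hu : u ∈ Ioc (0 : ℝ) 1) :
    (u : ℂ) ^ (z - 1) * cauchyKernel F r u = (2 * (Real.pi : ℂ) * Complex.I)⁻¹ *
      ∫ θ in Ioc 0 (2 * Real.pi), (deriv (circleMap 1 r) θ *
        (F (circleMap 1 r θ) * (circleMap 1 r θ ^ 2)⁻¹)) *
          (u : ℂ) ^ (z - 1 - (circleMap 1 r θ)⁻¹) := by
  rw [cauchyKernel, indicator_of_mem hu, circleIntegral,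
    intervalIntegral.integral_of_le Real.two_pi_pos.le, mul_left_comm, ← integral_const_mul]
  congr 2 with θ
  rw [sub_eq_add_neg (z - 1), Complex.cpow_add _ _ (Complex.ofReal_ne_zero.2 hu.1.ne'), smul_eq_mul]
  ring

theorem cpow_mul_cauchyKernel_eq_indicator (z : ℂ) :
    (fun u : ℝ => (u : ℂ) ^ (z - 1) * cauchyKernel F r u) = (Ioc (0 : ℝ) 1).indicator fun u : ℝ =>
      (2 * (Real.pi : ℂ) * Complex.I)⁻¹ *
      ∫ θ in Ioc 0 (2 * Real.pi), (deriv (circleMap 1 r) θ *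
        (F (circleMap 1 r θ) * (circleMap 1 r θ ^ 2)⁻¹)) *
          (u : ℂ) ^ (z - 1 - (circleMap 1 r θ)⁻¹) := by
  ext u
  by_cases hu : u ∈ Ioc (0 : ℝ) 1
  · rw [indicator_of_mem hu, cpow_mul_cauchyKernel z hu]
  · rw [indicator_of_notMem hu, cauchyKernel_of_notMem hu, mul_zero]

theorem integrable_cpow_mul_cauchyKernel (hr : 1 < r) (hF : ContinuousOn F (Metric.sphere 1 r))
    {z : ℂ} (hz : 1 / 2 ≤ z.re) :
    Integrable fun u : ℝ => (u : ℂ) ^ (z - 1) * cauchyKernel F r u := by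
  rw [cpow_mul_cauchyKernel_eq_indicator, integrable_indicator_iff measurableSet_Ioc]
  exact (integrable_mellin_cauchyIntegrand hr hF hz).integral_prod_left.const_mul _

theorem integrableOn_cauchyKernel (hr : 1 < r) (hF : ContinuousOn F (Metric.sphere 1 r)) :
    IntegrableOn (fun u : ℝ => cauchyKernel F r u * ((u ^ (-(1 / 2) : ℝ) : ℝ) : ℂ)) (Ioi 0) := by
  refine ((integrable_cpow_mul_cauchyKernel hr hF (z := 1 / 2)
    (by norm_num)).integrableOn (s := Ioi 0)).congr_fun (fun u hu => ?_) measurableSet_Ioi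
  dsimp only
  rw [mul_comm, Complex.ofReal_cpow (le_of_lt hu)]
  norm_num

/-- By Fubini the `u`-integral is done first, giving `(z - 1/w)⁻¹`. Then `w⁻² (z - 1/w)⁻¹ = (w -
1/z)⁻¹ - w⁻¹`, and each term is a Cauchy integral, for `F(1/z)` and `F(0)`. -/
theorem mellin_cauchyKernel (hr : 1 < r) (hF : AnalyticOnNhd ℂ F (Metric.closedBall 1 r))
    {z : ℂ} (hz : 1 / 2 ≤ z.re) : mellin (cauchyKernel F r) z = F z⁻¹ - F 0 := by
  have hr0 : 0 ≤ r := zero_le_one.trans hr.le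
  have hFc : ContinuousOn F (Metric.sphere 1 r) :=
    hF.continuousOn.mono Metric.sphere_subset_closedBall
  have hz0 : z ≠ 0 := by
    rintro rfl
    norm_num at hz
  have hzr : z⁻¹ ∈ Metric.ball (1 : ℂ) r :=
    Metric.closedBall_subset_ball hr (inv_mem_closedBall hz)
  have h0r : (0 : ℂ) ∈ Metric.ball (1 : ℂ) r := by simpa using hr
  have hlt : (1 + r)⁻¹ < 1 / 2 := by
    rw [inv_eq_one_div]
    exact one_div_lt_one_div_of_lt (by norm_num) (by linarith)
  have hci : ∀ w ∈ Metric.ball (1 : ℂ) r, CircleIntegrable (fun v => (v - w)⁻¹ * F v) 1 r := by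
    intro w hw
    refine ContinuousOn.circleIntegrable hr0 ((ContinuousOn.inv₀ (by fun_prop) ?_).mul hFc)
    rintro v hv hvw
    rw [sub_eq_zero.1 hvw] at hv
    exact (Metric.mem_ball.1 hw).ne (Metric.mem_sphere.1 hv)
  have h1 : mellin (cauchyKernel F r) z =
      ∫ u : ℝ, (u : ℂ) ^ (z - 1) * cauchyKernel F r u := by
    refine setIntegral_eq_integral_of_forall_compl_eq_zero fun u hu => ?_
    rw [cauchyKernel_of_notMem fun h => hu h.1, smul_zero]
  rw [h1, cpow_mul_cauchyKernel_eq_indicator, integral_indicator measurableSet_Ioc,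
    integral_const_mul, integral_integral_swap (integrable_mellin_cauchyIntegrand hr hFc hz),
    ← two_pi_I_inv_mul_circleIntegral hF hzr, ← two_pi_I_inv_mul_circleIntegral hF h0r, ← mul_sub,
    ← circleIntegral.integral_sub (hci _ hzr) (hci _ h0r), circleIntegral,
    intervalIntegral.integral_of_le Real.two_pi_pos.le]
  congr 2 with θ
  have hre := re_inv_le_of_mem_sphere hr (circleMap_mem_sphere 1 hr0 θ)
  have hw0 := circleMap_one_ne_zero hr θ
  have hwz := sub_ne_zero.2 (fun h : circleMap 1 r θ = z⁻¹ =>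
    (Metric.mem_ball.1 hzr).ne (Metric.mem_sphere.1 (h ▸ circleMap_mem_sphere 1 hr0 θ)))
  rw [integral_const_mul, ← intervalIntegral.integral_of_le zero_le_one, integral_cpow]
  · generalize deriv (circleMap 1 r) θ = d
    generalize circleMap 1 r θ = w at *
    have h3 : z - 1 - w⁻¹ + 1 = (w - z⁻¹) * z / w := by
      field_simp
      ring
    have h4 : z - 1 - w⁻¹ + 1 ≠ 0 := by
      -- The point `1/z` lies inside the circle, so `w ≠ 1/z` and the antiderivative's exponent is
      -- nonzero; hence it vanishes at `u = 0`.
      rw [h3]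
      exact div_ne_zero (mul_ne_zero hwz hz0) hw0
    have h5 : w - z⁻¹ = (w * z - 1) / z := by field_simp
    have h6 : w * z - 1 ≠ 0 := fun h => hwz (by rw [h5, h, zero_div])
    rw [Complex.ofReal_one, Complex.one_cpow, Complex.ofReal_zero, Complex.zero_cpow h4, h3,
      smul_eq_mul, sub_zero, sub_zero, h5]
    field_simp
    ring
  · left
    rw [Complex.sub_re, Complex.sub_re, Complex.one_re]
    linarith

end

theorem exists_analyticOnNhd_closedBall {F : ℂ → ℂ}
    (hF : AnalyticOnNhd ℂ F (Metric.closedBall (1 : ℂ) 1)) :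
    ∃ r : ℝ, 1 < r ∧ AnalyticOnNhd ℂ F (Metric.closedBall (1 : ℂ) r) := by
  obtain ⟨δ, hδ, h⟩ := (isCompact_closedBall (1 : ℂ) 1).exists_cthickening_subset_open
    (isOpen_analyticAt ℂ F) hF
  refine ⟨1 + δ, by linarith, fun z hz => h ?_⟩
  rw [cthickening_closedBall hδ.le zero_le_one]
  rwa [add_comm]

/-! ### Polynomials in `L²[0,1]` -/

open Polynomial in
theorem memLp_indicator_polynomial (p : ℂ[X]) :
    MemLp ((Ioo (0 : ℝ) 1).indicator fun x : ℝ => p.eval (x : ℂ)) 2 volume := by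
  have hc : Continuous fun x : ℝ => p.eval (x : ℂ) :=
    p.continuous.comp Complex.continuous_ofReal
  obtain ⟨M, hM⟩ := (isCompact_Icc (a := (0 : ℝ)) (b := 1)).exists_bound_of_continuousOn
    hc.continuousOn
  rw [memLp_indicator_iff_restrict measurableSet_Ioo]
  refine MemLp.of_bound hc.aestronglyMeasurable M ?_
  exact (ae_restrict_iff' measurableSet_Ioo).2
    (ae_of_all _ fun x hx => hM x (Ioo_subset_Icc_self hx))

open Polynomial in
/-- Polynomials as elements of `L²[0,1]`. -/
noncomputable def polyL2 : ℂ[X] →ₗ[ℂ] L2I where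
  toFun p := ⟨(memLp_indicator_polynomial p).toLp _, by
    filter_upwards [(memLp_indicator_polynomial p).coeFn_toLp] with x hx hx'
    rw [hx]
    exact indicator_of_notMem (fun h => hx' (Ioo_subset_Icc_self h)) _⟩
  map_add' p q := by
    apply Subtype.ext
    simp only [Submodule.coe_add]
    rw [← MemLp.toLp_add, MemLp.toLp_eq_toLp_iff]
    refine ae_of_all _ fun x => ?_
    by_cases h : x ∈ Ioo (0 : ℝ) 1
    · simp only [indicator_of_mem h, Pi.add_apply, eval_add]
    · simp only [indicator_of_notMem h, Pi.add_apply, add_zero]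
  map_smul' c p := by
    apply Subtype.ext
    simp only [Submodule.coe_smul, RingHom.id_apply]
    rw [← MemLp.toLp_const_smul, MemLp.toLp_eq_toLp_iff]
    refine ae_of_all _ fun x => ?_
    by_cases h : x ∈ Ioo (0 : ℝ) 1
    · simp only [indicator_of_mem h, Pi.smul_apply, eval_smul]
    · simp only [indicator_of_notMem h, Pi.smul_apply, smul_zero]

open Polynomial in
theorem coeFn_polyL2 (p : ℂ[X]) : ((polyL2 p : L2I) : L2R) =ᵐ[volume]
    (Ioo (0 : ℝ) 1).indicator fun x : ℝ => p.eval (x : ℂ) :=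
  (memLp_indicator_polynomial p).coeFn_toLp

/-! ### Hausdorff operators acting on monomials -/

theorem coeFn_truncate (f : L2R) : ((truncate f : L2I) : L2R) =ᵐ[volume]
    (Ioo (0 : ℝ) 1).indicator f :=
  ((Lp.memLp f).indicator measurableSet_Ioo).coeFn_toLp

theorem coeFn_hausdorffOp {K : ℝ → ℂ} (hK : AdmissibleKernel K) (f : L2R) :
    hausdorffOp K hK f =ᵐ[volume] fun x : ℝ => ∫ u : ℝ, K u * f (u * x) :=
  (hK.memLp f).coeFn_toLp

open Polynomial in
/-- Monomials are eigenvectors of Hausdorff operators with kernels supported in `[0,1]`. -/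
theorem biRestrict_hausdorffOp_polyL2_X_pow {K : ℝ → ℂ} (hK : AdmissibleKernel K)
    (h01 : ∀ᵐ u : ℝ, u ∉ Ioc (0 : ℝ) 1 → K u = 0) (n : ℕ) :
    biRestrict (hausdorffOp K hK) (polyL2 (X ^ n)) = mellin K (n + 1) • polyL2 (X ^ n) := by
  apply Subtype.ext
  apply Lp.ext
  have hne : ∀ᵐ x : ℝ, x ≠ 0 := by simp [ae_iff]
  have hm : mellin K (n + 1) = ∫ u : ℝ, K u * (u : ℂ) ^ n := by
    rw [mellin, ← integral_indicator measurableSet_Ioi]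
    refine integral_congr_ae ?_
    filter_upwards [h01] with u hu
    by_cases h : 0 < u
    · rw [indicator_of_mem (mem_Ioi.2 h), add_sub_cancel_right, Complex.cpow_natCast, smul_eq_mul,
        mul_comm]
    · rw [indicator_of_notMem (by simpa using h), hu fun h' => h h'.1, zero_mul]
  filter_upwards [hne, coeFn_truncate (hausdorffOp K hK (polyL2 (X ^ n) : L2I)),
    coeFn_hausdorffOp hK (polyL2 (X ^ n) : L2I), coeFn_polyL2 (X ^ n),
    Lp.coeFn_smul (mellin K (n + 1)) ((polyL2 (X ^ n) : L2I) : L2R)] with x hx0 h1 h2 h3 h4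
  refine h1.trans (Eq.trans ?_ h4.symm)
  rw [Pi.smul_apply, h3]
  by_cases hx : x ∈ Ioo (0 : ℝ) 1
  · rw [indicator_of_mem hx, indicator_of_mem hx, h2, hm, smul_eq_mul, ← integral_mul_const]
    refine integral_congr_ae ?_
    filter_upwards [h01, ae_comp_dilation (coeFn_polyL2 (X ^ n)) hx0] with u hu1 hu2
    by_cases hu : u ∈ Ioc (0 : ℝ) 1
    -- Support in `(0,1]` is used here: dilation by such `u` stays in `(0,1)`, so the truncation of
    -- `x^n` is never seen.
    · have hux : u * x ∈ Ioo (0 : ℝ) 1 :=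
        ⟨mul_pos hu.1 hx.1, (mul_le_of_le_one_left hx.1.le hu.2).trans_lt hx.2⟩
      rw [hu2, indicator_of_mem hux]
      simp only [eval_pow, eval_X]
      push_cast
      ring
    · simp only [hu1 hu, zero_mul]
  · rw [indicator_of_notMem hx, indicator_of_notMem hx, smul_zero]

theorem mellin_cesaroKernel {z : ℂ} (hz : 0 < z.re) : mellin cesaroKernel z = 1 / z := by
  rw [← (hasMellin_one_Ioc hz).2]
  refine setIntegral_congr_ae measurableSet_Ioi ?_
  have h1 : ∀ᵐ x : ℝ, x ≠ 1 := by simp [ae_iff]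
  filter_upwards [h1] with u hu _
  congr 1
  by_cases h : u ∈ Ioo (0 : ℝ) 1
  · simp [cesaroKernel, h, h.1, h.2.le]
  · have h' : u ∉ Ioc (0 : ℝ) 1 := fun h' => h ⟨h'.1, lt_of_le_of_ne h'.2 hu⟩
    rw [cesaroKernel, indicator_of_notMem h, indicator_of_notMem h']

open Polynomial in
theorem cesaroI_polyL2_X_pow (n : ℕ) :
    cesaroI (polyL2 (X ^ n)) = ((n : ℂ) + 1)⁻¹ • polyL2 (X ^ n) := by
  rw [← one_div, ← mellin_cesaroKernel (z := n + 1) (by simp; positivity)]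
  refine biRestrict_hausdorffOp_polyL2_X_pow admissible_cesaroKernel
    (ae_of_all _ fun u hu => indicator_of_notMem (fun h => hu (Ioo_subset_Ioc_self h)) _) n

/-! ### Density of polynomials in `L²[0,1]` -/

/-- By Weierstrass, a test function is within `ε` of a polynomial on `[0,1]`; polynomials integrate
to zero against `g`, so the pairing is at most `ε ‖g‖₁`. -/
theorem ae_eq_zero_of_moments {g : ℝ → ℂ} (hg : Integrable g)
    (h01 : ∀ᵐ x : ℝ, x ∉ Icc (0 : ℝ) 1 → g x = 0)
    (h : ∀ n : ℕ, ∫ x : ℝ, (x : ℂ) ^ n * g x = 0) : ∀ᵐ x : ℝ, g x = 0 := by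
  have hint : ∀ φ : ℝ → ℝ, Continuous φ → Integrable fun x => (φ x : ℂ) * g x := by
    intro φ hφ
    obtain ⟨M, hM⟩ := (isCompact_Icc (a := (0 : ℝ)) (b := 1)).exists_bound_of_continuousOn
      hφ.continuousOn
    refine (hg.norm.const_mul M).mono' ((Complex.continuous_ofReal.comp hφ).aestronglyMeasurable.mul hg.1) ?_
    filter_upwards [h01] with x hx
    by_cases hx' : x ∈ Icc (0 : ℝ) 1
    · rw [norm_mul, Complex.norm_real]
      exact mul_le_mul_of_nonneg_right (hM x hx') (norm_nonneg _)
    · simp [hx hx']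
  have hpoly : ∀ p : Polynomial ℝ, ∫ x : ℝ, ((p.eval x : ℝ) : ℂ) * g x = 0 := by
    intro p
    induction p using Polynomial.induction_on' with
    | add p q hp hq =>
      simp only [Polynomial.eval_add, Complex.ofReal_add, add_mul]
      rw [integral_add (hint _ p.continuous)
        (hint _ q.continuous), hp, hq, add_zero]
    | monomial n a =>
      simp only [Polynomial.eval_monomial, Complex.ofReal_mul, Complex.ofReal_pow, mul_assoc]
      rw [integral_const_mul, h, mul_zero]
  refine ae_eq_zero_of_integral_contDiff_smul_eq_zero hg.locallyIntegrable fun φ hφ _ => ?_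
  set C := ∫ x, ‖g x‖ with hC
  have hC0 : 0 ≤ C := integral_nonneg fun _ => norm_nonneg _
  have hsmall : ∀ ε : ℝ, 0 < ε → ‖∫ x, φ x • g x‖ ≤ ε * C := by
    intro ε hε
    obtain ⟨p, hp⟩ := exists_polynomial_near_of_continuousOn 0 1 φ hφ.continuous.continuousOn ε hε
    have h1 : ∫ x, φ x • g x = ∫ x, ((φ x : ℂ) - (p.eval x : ℝ)) * g x := by
      simp only [sub_mul]
      rw [integral_sub (hint _ hφ.continuous)
        (hint _ p.continuous), hpoly, sub_zero]
      simp only [Complex.real_smul]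
    rw [h1, hC, ← integral_const_mul]
    refine norm_integral_le_of_norm_le (hg.norm.const_mul ε) ?_
    filter_upwards [h01] with x hx
    by_cases hx' : x ∈ Icc (0 : ℝ) 1
    · rw [norm_mul, ← Complex.ofReal_sub, Complex.norm_real, norm_sub_rev]
      exact mul_le_mul_of_nonneg_right (hp x hx').le (norm_nonneg _)
    · simp [hx hx']
  rw [← norm_le_zero_iff]
  -- The `+ 1` keeps the denominator positive when `C = 0`.
  refine le_of_forall_pos_le_add fun δ hδ => (hsmall (δ / (C + 1)) (by positivity)).trans ?_
  rw [zero_add, div_mul_eq_mul_div, div_le_iff₀ (by positivity)]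
  nlinarith

open Polynomial in
-- An element orthogonal to all monomials has vanishing moments; it is integrable because `[0,1]`
-- has finite measure.
theorem denseRange_polyL2 : DenseRange polyL2 := by
  have h : (LinearMap.range polyL2).topologicalClosure = ⊤ := by
    rw [Submodule.topologicalClosure_eq_top_iff, Submodule.eq_bot_iff]
    intro g hg
    have h01 : ∀ᵐ x : ℝ, x ∉ Icc (0 : ℝ) 1 → (g : L2R) x = 0 := g.2
    have hgi : Integrable (g : L2R) := by
      have h1 : IntegrableOn (g : L2R) (Icc 0 1) :=
        ((Lp.memLp (g : L2R)).restrict (Icc 0 1)).integrable (by norm_num)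
      refine (h1.integrable_indicator measurableSet_Icc).congr ?_
      filter_upwards [h01] with x hx
      by_cases hx' : x ∈ Icc (0 : ℝ) 1
      · rw [indicator_of_mem hx']
      · rw [indicator_of_notMem hx', hx hx']
    have h2 := ae_eq_zero_of_moments hgi h01 fun n => by
      have h3 : inner ℂ ((polyL2 (X ^ n) : L2I) : L2R) (g : L2R) = 0 :=
        (Submodule.mem_orthogonal _ _).1 hg _ ⟨X ^ n, rfl⟩
      rw [L2.inner_def] at h3
      rw [← h3]
      refine integral_congr_ae ?_
      have h0 : ∀ᵐ x : ℝ, x ≠ 0 := by simp [ae_iff]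
      have h1 : ∀ᵐ x : ℝ, x ≠ 1 := by simp [ae_iff]
      filter_upwards [coeFn_polyL2 (X ^ n), h01, h0, h1] with x hx hx' hx0 hx1
      by_cases h : x ∈ Ioo (0 : ℝ) 1
      · rw [hx, indicator_of_mem h]
        simp [mul_comm]
      · rw [hx' fun h' => h ⟨lt_of_le_of_ne h'.1 (Ne.symm hx0), lt_of_le_of_ne h'.2 hx1⟩,
          mul_zero, inner_zero_right]
    apply Subtype.ext
    apply Lp.ext
    refine EventuallyEq.trans h2 (Lp.coeFn_zero ℂ 2 (volume : Measure ℝ)).symm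
  intro f
  have : f ∈ (LinearMap.range polyL2).topologicalClosure := h ▸ Submodule.mem_top
  rwa [← SetLike.mem_coe, Submodule.topologicalClosure_coe, LinearMap.coe_range] at this

/-! ### The spectrum of the Cesàro operator on `L²[0,1]` -/

open Polynomial in
theorem norm_sq_polyL2 (p : ℂ[X]) :
    ‖polyL2 p‖ ^ 2 = ∫ x in (0 : ℝ)..1, ‖p.eval (x : ℂ)‖ ^ 2 := by
  have h1 : ((‖polyL2 p‖ ^ 2 : ℝ) : ℂ) = inner ℂ ((polyL2 p : L2I) : L2R) (polyL2 p : L2I) := by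
    rw [inner_self_eq_norm_sq_to_K]
    simp
  rw [L2.inner_def] at h1
  rw [intervalIntegral.integral_of_le zero_le_one, integral_Ioc_eq_integral_Ioo,
    ← integral_indicator measurableSet_Ioo]
  apply Complex.ofReal_injective
  rw [h1, ← integral_complex_ofReal]
  refine integral_congr_ae ?_
  filter_upwards [coeFn_polyL2 p] with x hx
  rw [hx]
  by_cases h : x ∈ Ioo (0 : ℝ) 1
  · rw [indicator_of_mem h, indicator_of_mem h, inner_self_eq_norm_sq_to_K]
    simp
  · rw [indicator_of_notMem h, indicator_of_notMem h, inner_zero_right, Complex.ofReal_zero]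

open Polynomial in
/-- The Cesàro operator inverts `q ↦ (xq)'` on polynomials. -/
theorem exists_cesaroI_polyL2_eq (p : ℂ[X]) :
    ∃ q : ℂ[X], p = q + X * derivative q ∧ cesaroI (polyL2 p) = polyL2 q := by
  induction p using Polynomial.induction_on' with
  | add p₁ p₂ h₁ h₂ =>
    obtain ⟨q₁, h₁, h₁'⟩ := h₁
    obtain ⟨q₂, h₂, h₂'⟩ := h₂
    refine ⟨q₁ + q₂, ?_, by rw [map_add, map_add, map_add, h₁', h₂']⟩
    rw [derivative_add]
    linear_combination h₁ + h₂
  | monomial n a =>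
    have hn : (n : ℂ) + 1 ≠ 0 := Nat.cast_add_one_ne_zero n
    refine ⟨(a * ((n : ℂ) + 1)⁻¹) • X ^ n, ?_, ?_⟩
    · rw [← C_mul_X_pow_eq_monomial, derivative_smul, derivative_X_pow, smul_eq_C_mul,
        smul_eq_C_mul]
      have h1 : X * (C (n : ℂ) * X ^ (n - 1)) = C (n : ℂ) * X ^ n := by
        rcases n with _ | n
        · simp
        · rw [Nat.add_sub_cancel, pow_succ]
          ring
      rw [mul_left_comm, h1, ← mul_assoc, ← add_mul, ← C_mul, ← C_add]
      congr 2
      field_simp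
      ring
    · rw [← C_mul_X_pow_eq_monomial, ← smul_eq_C_mul, map_smul, map_smul, cesaroI_polyL2_X_pow,
        map_smul, smul_smul]

open Polynomial in
-- Pointwise, `|q + xq'|² - |xq'|² = |q|² + 2 Re(q̄ · xq') = (x|q|²)'`. Integrating over `[0,1]`
-- leaves `|q(1)|² ≥ 0`.
theorem norm_polyL2_mul_derivative_le (q : ℂ[X]) :
    ‖polyL2 (X * derivative q)‖ ≤ ‖polyL2 (q + X * derivative q)‖ := by
  have hd : ∀ x : ℝ, HasDerivAt (fun x : ℝ => q.eval (x : ℂ)) ((derivative q).eval (x : ℂ)) x :=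
    fun x => (q.hasDerivAt (x : ℂ)).comp_ofReal
  have hd' : ∀ x : ℝ, HasDerivAt (fun x : ℝ => x * ‖q.eval (x : ℂ)‖ ^ 2)
      (‖(q + X * derivative q).eval (x : ℂ)‖ ^ 2 - ‖(X * derivative q).eval (x : ℂ)‖ ^ 2) x := by
    intro x
    refine ((hasDerivAt_id x).mul (hd x).norm_sq).congr_deriv ?_
    simp only [eval_add, eval_mul, eval_X, id, one_mul]
    rw [← Complex.real_smul, norm_add_sq_real, inner_smul_right]
    ring
  have hc : ∀ p : ℂ[X], IntervalIntegrable (fun x : ℝ => ‖p.eval (x : ℂ)‖ ^ 2) volume 0 1 :=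
    fun p => Continuous.intervalIntegrable
      ((p.continuous.comp Complex.continuous_ofReal).norm.pow 2) 0 1
  have h1 := intervalIntegral.integral_eq_sub_of_hasDerivAt (fun x _ => hd' x)
    ((hc (q + X * derivative q)).sub (hc (X * derivative q)))
  rw [intervalIntegral.integral_sub (hc _) (hc _), ← norm_sq_polyL2, ← norm_sq_polyL2] at h1
  rw [← sq_le_sq₀ (norm_nonneg _) (norm_nonneg _), ← sub_nonneg, h1]
  simp

/-- On a polynomial `p = (xq)' = q + xq'` one has `(𝓒₁ - 1)p = -xq'`, so the previous inequality is
the bound on a dense subspace. -/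
theorem norm_cesaroI_sub_one_le : ‖cesaroI - 1‖ ≤ 1 := by
  refine ContinuousLinearMap.opNorm_le_bound _ zero_le_one fun f => ?_
  rw [one_mul]
  refine denseRange_polyL2.induction_on (p := fun f => ‖(cesaroI - 1) f‖ ≤ ‖f‖) f
    (isClosed_le (by fun_prop) continuous_norm) fun p => ?_
  obtain ⟨q, hp, hq⟩ := exists_cesaroI_polyL2_eq p
  rw [_root_.sub_apply, one_apply_eq_self, hq, norm_sub_rev, ← map_sub]
  nth_rewrite 2 [hp]
  rw [show p - q = Polynomial.X * Polynomial.derivative q by rw [sub_eq_iff_eq_add', ← hp]]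
  exact norm_polyL2_mul_derivative_le q

theorem spectrum_subset_closedBall_one {E : Type*} [NormedAddCommGroup E] [NormedSpace ℂ E]
    [CompleteSpace E] {A : E →L[ℂ] E} (hA : ‖A - 1‖ ≤ 1) :
    spectrum ℂ A ⊆ Metric.closedBall 1 1 := by
  intro z hz
  have h2 : z - 1 ∈ spectrum ℂ (A - 1) := by
    have := spectrum.sub_singleton_eq A (1 : ℂ)
    rw [map_one] at this
    rw [← this]
    exact Set.sub_mem_sub hz (mem_singleton _)
  rw [mem_closedBall_iff_norm]
  refine (spectrum.norm_le_norm_mul_of_mem h2).trans ?_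
  -- The norm of the identity is only bounded by `1`, since `E` may be trivial.
  exact mul_le_one₀ hA (norm_nonneg _) ContinuousLinearMap.norm_id_le

theorem spectrum_cesaroI_subset : spectrum ℂ cesaroI ⊆ Metric.closedBall 1 1 :=
  spectrum_subset_closedBall_one norm_cesaroI_sub_one_le

/-! ### The functional calculus on eigenvectors -/

section

variable {E : Type*} [NormedAddCommGroup E] [NormedSpace ℂ E] {A : E →L[ℂ] E} {v : E} {μ : ℂ}

theorem mem_spectrum_of_eigenvector (hv : A v = μ • v) (hv0 : v ≠ 0) : μ ∈ spectrum ℂ A := by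
  intro h
  apply hv0
  have h1 : (algebraMap ℂ (E →L[ℂ] E) μ - A) v = 0 := by
    rw [_root_.sub_apply, hv, Algebra.algebraMap_eq_smul_one, _root_.smul_apply,
      one_apply_eq_self, sub_self]
  have h2 := congrArg (fun T : E →L[ℂ] E => T v) (Ring.inverse_mul_cancel _ h)
  simpa [h1] using h2.symm

theorem resolvent_apply_of_eigenvector (hv : A v = μ • v) {z : ℂ} (hz : z ∉ spectrum ℂ A)
    (hzμ : z ≠ μ) : resolvent A z v = (z - μ)⁻¹ • v := by
  have h1 : (algebraMap ℂ (E →L[ℂ] E) z - A) v = (z - μ) • v := by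
    rw [_root_.sub_apply, hv, Algebra.algebraMap_eq_smul_one, _root_.smul_apply,
      one_apply_eq_self, sub_smul]
  have h2 := congrArg (fun T : E →L[ℂ] E => T v)
    (Ring.inverse_mul_cancel _ (spectrum.notMem_iff.1 hz))
  rw [resolvent, eq_inv_smul_iff₀ (sub_ne_zero.2 hzμ), ← map_smul, ← h1]
  exact h2

/-- Evaluation at `v` commutes with the integral, and the resolvent acts on `v` as `(z - μ)⁻¹`; what
remains is Cauchy's formula for `F μ`. -/
theorem dunfordIntegral_apply_of_eigenvector [CompleteSpace E] (hv : A v = μ • v) {F : ℂ → ℂ}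
    {c : ℂ} {R : ℝ} (hR : 0 < R) (hA : spectrum ℂ A ⊆ Metric.ball c R) (hμ : μ ∈ Metric.ball c R)
    (hF : AnalyticOnNhd ℂ F (Metric.closedBall c R)) : dunfordIntegral F A c R v = F μ • v := by
  have hout : ∀ z ∈ Metric.sphere c R, z ∉ Metric.ball c R := fun z hz h =>
    (Metric.mem_ball.1 h).ne (Metric.mem_sphere.1 hz)
  have hcont : ContinuousOn (fun z => F z • resolvent A z) (Metric.sphere c R) := by
    refine (hF.continuousOn.mono Metric.sphere_subset_closedBall).smul fun z hz => ?_
    exact (spectrum.hasDerivAt_resolvent_const_left (spectrum.notMem_iff.1 fun h =>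
      hout z hz (hA h))).continuousAt.continuousWithinAt
  have hint := (hcont.circleIntegrable hR.le).out
  rw [dunfordIntegral, _root_.smul_apply, circleIntegral,
    ContinuousLinearMap.intervalIntegral_apply hint, ← two_pi_I_inv_mul_circleIntegral hF hμ,
    mul_smul, ← circleIntegral.integral_smul_const]
  congr 1
  refine circleIntegral.integral_congr hR.le (f := fun z => (F z • resolvent A z) v)
    fun z hz => ?_
  dsimp only
  rw [_root_.smul_apply, resolvent_apply_of_eigenvector hv (fun h => hout z hz (hA h))
    (fun h => hout z hz (h ▸ hμ)), smul_smul, mul_comm]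

end

/-! ### Comparison of operators on monomials, and conclusion -/

open Polynomial in
theorem polyL2_X_pow_ne_zero (n : ℕ) : polyL2 (X ^ n) ≠ 0 := by
  intro h
  have h1 := norm_sq_polyL2 (X ^ n)
  have h2 : ∫ x in (0 : ℝ)..1, ‖(X ^ n : ℂ[X]).eval (x : ℂ)‖ ^ 2 =
      ∫ x in (0 : ℝ)..1, x ^ (2 * n) := by
    refine intervalIntegral.integral_congr fun x _ => ?_
    simp only [eval_pow, eval_X, norm_pow, Complex.norm_real, Real.norm_eq_abs]
    rw [← pow_mul, mul_comm, pow_mul, pow_mul, sq_abs]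
  rw [h2, h, integral_pow, norm_zero] at h1
  simp at h1
  exact (Nat.cast_add_one_ne_zero (R := ℝ) (2 * n)) (by exact_mod_cast h1.symm)

open Polynomial in
theorem ext_on_monomials {S T : L2I →L[ℂ] L2I}
    (h : ∀ n : ℕ, S (polyL2 (X ^ n)) = T (polyL2 (X ^ n))) : S = T := by
  refine DFunLike.coe_injective (denseRange_polyL2.equalizer S.continuous T.continuous ?_)
  ext1 p
  simp only [Function.comp_apply]
  induction p using Polynomial.induction_on' with
  | add p q hp hq => rw [map_add, map_add, map_add, hp, hq]
  | monomial n a =>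
    rw [← C_mul_X_pow_eq_monomial, ← smul_eq_C_mul, map_smul, map_smul, map_smul, h]

/-- Identifying `K` with the Cauchy kernel supplies what the critical line alone does not show:
support in `(0,1]` and the Mellin values at `n + 1`. -/
theorem isHolomorphicFunctionOf_hausdorffOp {F : ℂ → ℂ}
    (hF : AnalyticOnNhd ℂ F (Metric.closedBall (1 : ℂ) 1)) {K : ℝ → ℂ}
    (ha : ∀ᵐ u : ℝ, u < 0 → K u = 0)
    (hb : IntegrableOn (fun u : ℝ => K u * ((u ^ (-(1 / 2) : ℝ) : ℝ) : ℂ)) (Ioi 0))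
    (hc : ∀ z : ℂ, z.re = 1 / 2 → mellin K z = F z⁻¹) :
    F 0 = 0 ∧ IsHolomorphicFunctionOf F cesaroI
      (biRestrict (hausdorffOp K (admissible_of_halfLine ha hb))) := by
  have hF0 : F 0 = 0 := eq_zero_of_mellin_eq (hF 0 (by simp)).continuousAt hc
  obtain ⟨r, hr, hFr⟩ := exists_analyticOnNhd_closedBall hF
  have hmr : ∀ z : ℂ, 1 / 2 ≤ z.re → mellin (cauchyKernel F r) z = F z⁻¹ := fun z hz => by
    rw [mellin_cauchyKernel hr hFr hz, hF0, sub_zero]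
  have hKL : K =ᵐ[volume] cauchyKernel F r := by
    refine ae_eq_of_mellin_eq ha
      (ae_of_all _ fun u hu => cauchyKernel_of_notMem fun h => h.1.not_gt hu) hb
      (integrableOn_cauchyKernel hr (hFr.continuousOn.mono Metric.sphere_subset_closedBall))
      fun z hz => ?_
    rw [hc z hz, hmr z hz.ge]
  have h01 : ∀ᵐ u : ℝ, u ∉ Ioc (0 : ℝ) 1 → K u = 0 := by
    filter_upwards [hKL] with u hu hu'
    rw [hu, cauchyKernel_of_notMem hu']
  have hm : ∀ n : ℕ, mellin K (n + 1) = F ((n : ℂ) + 1)⁻¹ := fun n => by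
    rw [← hmr _ (by simp; linarith [n.cast_nonneg (α := ℝ)])]
    refine setIntegral_congr_ae measurableSet_Ioi ?_
    filter_upwards [hKL] with u hu _
    rw [hu]
  refine ⟨hF0, ⟨1, r, by linarith,
    spectrum_cesaroI_subset.trans (Metric.closedBall_subset_ball hr), hFr⟩,
    fun c R hR hsp hFR => ext_on_monomials fun n => ?_⟩
  -- Since `x^n ≠ 0`, the eigenvalue `1/(n+1)` is in the spectrum and hence inside every admissible
  -- disc, so the choice of disc is irrelevant.
  have hn := cesaroI_polyL2_X_pow n
  rw [biRestrict_hausdorffOp_polyL2_X_pow _ h01, hm, dunfordIntegral_apply_of_eigenvector hn hR hsp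
    (hsp (mem_spectrum_of_eigenvector hn (polyL2_X_pow_ne_zero n))) hFR]

end CesaroCalculus

theorem mainTheorem8 (F : ℂ → ℂ) (hF : AnalyticOnNhd ℂ F (Metric.closedBall (1 : ℂ) 1)) :
    (F 0 = 0 →
      ∃ (K : ℝ → ℂ) (ha : ∀ᵐ u : ℝ, u < 0 → K u = 0)
        (hb : MeasureTheory.IntegrableOn
          (fun u : ℝ => K u * ((u ^ (-(1 / 2) : ℝ) : ℝ) : ℂ)) (Set.Ioi 0)),
        (∀ z : ℂ, z.re = 1 / 2 → mellin K z = F z⁻¹) ∧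
        CesaroCalculus.IsHolomorphicFunctionOf F CesaroCalculus.cesaroI
          (CesaroCalculus.biRestrict
            (CesaroCalculus.hausdorffOp K (CesaroCalculus.admissible_of_halfLine ha hb)))) ∧
    (∀ (K : ℝ → ℂ) (ha : ∀ᵐ u : ℝ, u < 0 → K u = 0)
        (hb : MeasureTheory.IntegrableOn
          (fun u : ℝ => K u * ((u ^ (-(1 / 2) : ℝ) : ℝ) : ℂ)) (Set.Ioi 0)),
        (∀ z : ℂ, z.re = 1 / 2 → mellin K z = F z⁻¹) →
        F 0 = 0 ∧
        CesaroCalculus.IsHolomorphicFunctionOf F CesaroCalculus.cesaroI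
          (CesaroCalculus.biRestrict
            (CesaroCalculus.hausdorffOp K (CesaroCalculus.admissible_of_halfLine ha hb)))) := by
  refine ⟨fun hF0 => ?_,
    fun K ha hb hc => CesaroCalculus.isHolomorphicFunctionOf_hausdorffOp hF ha hb hc⟩
  -- The Cauchy kernel is the witness: `F 0 = 0` removes the constant from its Mellin transform, and
  -- the converse direction then gives the operator identity.
  obtain ⟨r, hr, hFr⟩ := CesaroCalculus.exists_analyticOnNhd_closedBall hF
  have hb := CesaroCalculus.integrableOn_cauchyKernel hr
    (hFr.continuousOn.mono Metric.sphere_subset_closedBall)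
  have ha : ∀ᵐ u : ℝ, u < 0 → CesaroCalculus.cauchyKernel F r u = 0 :=
    ae_of_all _ fun u hu => CesaroCalculus.cauchyKernel_of_notMem fun h => h.1.not_gt hu
  have hc : ∀ z : ℂ, z.re = 1 / 2 → mellin (CesaroCalculus.cauchyKernel F r) z = F z⁻¹ :=
    fun z hz => by rw [CesaroCalculus.mellin_cauchyKernel hr hFr hz.ge, hF0, sub_zero]
  exact ⟨_, ha, hb, hc, (CesaroCalculus.isHolomorphicFunctionOf_hausdorffOp hF ha hb hc).2⟩
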